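/- Let $(\Delta,\mathcal D,\mathbb P)$ be a probability space (for instance $\Delta\subseteq\mathbb R^{n}$ with a $\sigma$-algebra $\mathcal D$), let $\mathbb P^m$ denote the product measure on $\Delta^m$, and let $T\in\mathcal D$ be a target concept. For $H\in\mathcal D$ put $d_{\mathbb P}(T,H)=\mathbb P\{\delta\in\Delta:\mathbf 1_H(\delta)\neq\mathbf 1_T(\delta)\}$, and call $H$ consistent with a labeled sample $\{(\delta_i,\mathbf 1_T(\delta_i))\}_{i\in J}$ if $\mathbf 1_H(\delta_i)=\mathbf 1_T(\delta_i)$ for all $i\in J$. An algorithm is a family $\{A_m\}_{m\ge m_0}$ of maps $A_m:[\Delta\times\{0,1\}]^m\to\mathcal D$; write $H_m=A_m(\{(\delta_i,\mathbf 1_T(\delta_i))\}_{i=1}^m)$. It is PAC-T with $q:\mathbb N\times(0,1)\to[0,1]$ if $\lim_{m\to\infty}q(m,\epsilon)=0$ for every $\epsilon\in(0,1)$ and $$\mathbb P^m\{(\delta_1,\dots,\delta_m)\in\Delta^m: d_{\mathbb P}(T,H_m)>\epsilon\}\le q(m,\epsilon)\qquad\text{for all }\epsilon\in(0,1),\ m\ge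 m_0 .$$ Let $d\in\mathbb N$ and $G_d:[\Delta\times\{0,1\}]^d\to\mathcal D$. For $m\ge d$ let $\mathcal I_d$ be the set of all $d$-element subsets of $\{1,\dots,m\}$, and for $I\in\mathcal I_d$ let $H_I=G_d(\{(\delta_i,\mathbf 1_T(\delta_i))\}_{i\in I})$, the samples being taken in the order of their indices. Suppose that for all $m\ge d$ and $I\in\mathcal I_d$ the set of $(\delta_1,\dots,\delta_m)\in\Delta^m$ for which $H_I$ is consistent with $\{(\delta_i,\mathbf 1_T(\delta_i))\}_{i=1}^m$ is measurable, and that for every $m\ge d$: 1. for every $(\delta_1,\dots,\delta_m)\in\Delta^m$ and every $I\in\mathcal I_d$, $H_I$ is consistent with $\{(\delta_i,\mathbf 1_T(\delta_i))\}_{i\in I}$; 2. with $\mathbb P^m$-probability one there is a unique $I\in\mathcal I_d$ such that $H_I$ is consistent with the whole labeled multisample $\{(\delta_i,\mathbf 1_T(\delta_i))\}_{i=1}^m$. Then there are maps $m_d:[\Delta\times\{0,1\}]^m\to\mathcal I_d$ $(m\ge d)$ such that, with $\mathbb P^m$-probability one, $H_{m_d}=G_d(\{(\delta_i,\mathbf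 1_T(\delta_i))\}_{i\in m_d})$, where $m_d$ is evaluated at $\{(\delta_i,\mathbf 1_T(\delta_i))\}_{i=1}^m$, is consistent with $\{(\delta_i,\mathbf 1_T(\delta_i))\}_{i=1}^m$. For any such maps, the compression algorithm $\{A_m\}_{m\ge d}$ that applies $G_d$ to the entries of its input with indices in the value of $m_d$ at that input (so that $H_m=H_{m_d}$) is PAC-T with $$q(m,\epsilon)=\sum_{i=0}^{d-1}\binom mi\epsilon^i(1-\epsilon)^{m-i}.$$ Moreover, for all $\epsilon\in(0,1)$ and $m\ge d$, the event $\{(\delta_1,\dots,\delta_m)\in\Delta^m:d_{\mathbb P}(T,H_m)>\epsilon\}$ is $\mathbb P^m$-measurable (it belongs to the completion of the product $\sigma$-algebra) and the bound holds with equality: $$\mathbb P^m\{(\delta_1,\dots,\delta_m)\in\Delta^m:d_{\mathbb P}(T,H_m)>\epsilon\}=\sum_{i=0}^{d-1}\binom mi\epsilon^i(1-\epsilon)^{m-i}.$$ -/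

import Mathlib

open MeasureTheory Filter Topology

namespace CompressionLearning

/-- Concepts (and hypotheses): the members of the σ-algebra of `Δ`. -/
abbrev Concept (Δ : Type*) [MeasurableSpace Δ] : Type _ :=
  {C : Set Δ // MeasurableSet C}

/-- The `{0,1}`-valued indicator function of a concept, with `{0,1}` modelled by `Bool`. -/
noncomputable def Concept.ind {Δ : Type*} [MeasurableSpace Δ] (C : Concept Δ) (x : Δ) : Bool :=
  open Classical in decide (x ∈ C.1)

/-- The labeled multisample `((δ₁, 1_T(δ₁)), …, (δₘ, 1_T(δₘ)))`. -/
noncomputable def label {Δ : Type*} [MeasurableSpace Δ] (T : Concept Δ) {m : ℕ}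
    (δ : Fin m → Δ) : Fin m → Δ × Bool :=
  fun i => (δ i, T.ind (δ i))

/-- `H` gives every sample point the label that it carries. -/
def IsConsistent {Δ : Type*} [MeasurableSpace Δ] (H : Concept Δ) {m : ℕ}
    (z : Fin m → Δ × Bool) : Prop :=
  ∀ i, H.ind (z i).1 = (z i).2

/-- The error `d_P(T,H) = P {δ : 1_H(δ) ≠ 1_T(δ)}`. -/
noncomputable def errorDist {Δ : Type*} [MeasurableSpace Δ] (P : Measure Δ)
    (T H : Concept Δ) : ℝ :=
  P.real {x | H.ind x ≠ T.ind x}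

/-- The law `P^m` of an `m`-multisample. -/
noncomputable def sampleLaw {Δ : Type*} [MeasurableSpace Δ] (P : Measure Δ) (m : ℕ) :
    Measure (Fin m → Δ) :=
  Measure.pi fun _ => P

/-- An algorithm: maps `A_m`, for `m ≥ m₀`, from labeled `m`-multisamples to hypotheses. -/
abbrev Algorithm (Δ : Type*) [MeasurableSpace Δ] (m₀ : ℕ) : Type _ :=
  ∀ m : ℕ, m₀ ≤ m → (Fin m → Δ × Bool) → Concept Δ

/-- The event `d_P(T, H_m) > ε`, where `H_m` is the hypothesis that `A_m` returns on the
multisample labeled by `T`. -/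
def errorEvent {Δ : Type*} [MeasurableSpace Δ] (P : Measure Δ) (T : Concept Δ) {m₀ : ℕ}
    (A : Algorithm Δ m₀) (m : ℕ) (hm : m₀ ≤ m) (ε : ℝ) : Set (Fin m → Δ) :=
  {δ | ε < errorDist P T (A m hm (label T δ))}

/-- The algorithm `A` is probably approximately correct for the target concept `T` (PAC-T),
with the function `q : ℕ × (0,1) → [0,1]` as its bound. -/
structure IsPACTWith {Δ : Type*} [MeasurableSpace Δ] (P : Measure Δ) (T : Concept Δ) {m₀ : ℕ}
    (A : Algorithm Δ m₀) (q : ℕ → ℝ → ℝ) : Prop where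
  mem_Icc : ∀ m : ℕ, ∀ ε ∈ Set.Ioo (0 : ℝ) 1, q m ε ∈ Set.Icc (0 : ℝ) 1
  tendsto_zero : ∀ ε ∈ Set.Ioo (0 : ℝ) 1, Tendsto (fun m => q m ε) atTop (𝓝 0)
  bound : ∀ ε ∈ Set.Ioo (0 : ℝ) 1, ∀ (m : ℕ) (hm : m₀ ≤ m),
    (sampleLaw P m).real (errorEvent P T A m hm ε) ≤ q m ε

/-- The sets of `d` indices out of `m`. -/
abbrev IndexSet (d m : ℕ) : Type := {I : Finset (Fin m) // I.card = d}

/-- The part of a multisample with indices in `I`, in the order of the indices. -/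
def subsample {α : Type*} {d m : ℕ} (z : Fin m → α) (I : IndexSet d m) : Fin d → α :=
  fun k => z (I.1.orderEmbOfFin I.2 k)

/-- The event that the hypothesis compressed from the samples with indices in `I` is consistent
with the whole labeled multisample. -/
def consistencyEvent {Δ : Type*} [MeasurableSpace Δ] (T : Concept Δ) {d : ℕ}
    (G : (Fin d → Δ × Bool) → Concept Δ) {m : ℕ} (I : IndexSet d m) : Set (Fin m → Δ) :=
  {δ | IsConsistent (G (subsample (label T δ) I)) (label T δ)}

/-- The strengthened consistency assumption on the compression map `G`. -/
structure UniqueConsistency {Δ : Type*} [MeasurableSpace Δ] (P : Measure Δ) (T : Concept Δ)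
    {d : ℕ} (G : (Fin d → Δ × Bool) → Concept Δ) : Prop where
  consistent_subsample : ∀ m : ℕ, d ≤ m → ∀ (δ : Fin m → Δ) (I : IndexSet d m),
    IsConsistent (G (subsample (label T δ) I)) (subsample (label T δ) I)
  existsUnique : ∀ m : ℕ, d ≤ m → ∀ᵐ δ ∂(sampleLaw P m),
    ∃! I : IndexSet d m, IsConsistent (G (subsample (label T δ) I)) (label T δ)

/-- A choice, for each `m ≥ d`, of `d` indices for each labeled `m`-multisample. -/
abbrev IndexSelection (Δ : Type*) (d : ℕ) : Type _ :=
  ∀ m : ℕ, d ≤ m → (Fin m → Δ × Bool) → IndexSet d m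

/-- With probability one, the hypothesis compressed from the samples with the selected indices
is consistent with the whole labeled multisample. -/
def IsCompressing {Δ : Type*} [MeasurableSpace Δ] (P : Measure Δ) (T : Concept Δ) {d : ℕ}
    (G : (Fin d → Δ × Bool) → Concept Δ) (μ : IndexSelection Δ d) : Prop :=
  ∀ (m : ℕ) (hm : d ≤ m), ∀ᵐ δ ∂(sampleLaw P m),
    IsConsistent (G (subsample (label T δ) (μ m hm (label T δ)))) (label T δ)

/-- The compression algorithm: apply `G` to the samples with the selected indices. -/
def compressionAlgorithm {Δ : Type*} [MeasurableSpace Δ] {d : ℕ}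
    (G : (Fin d → Δ × Bool) → Concept Δ) (μ : IndexSelection Δ d) : Algorithm Δ d :=
  fun m hm z => G (subsample z (μ m hm z))

/-- `q(m,ε) = ∑_{i=0}^{d-1} C(m,i) ε^i (1-ε)^(m-i)`; the terms with `i > m` vanish. -/
noncomputable def binomialTail (d m : ℕ) (ε : ℝ) : ℝ :=
  ∑ i ∈ Finset.range d, (m.choose i : ℝ) * ε ^ i * (1 - ε) ^ (m - i)

end CompressionLearning

namespace CompressionLearning

/-! Let `F` be the law, under `P^d`, of the probability `s` that the hypothesis compressed from `d`
points labels a fresh point correctly. Given the points in `I`, the other `m - d` points are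
independent, so `H_I` is consistent with everything with conditional probability `s ^ (m - d)`. The
consistency events are a.e. disjoint and cover almost everything, hence `C(m,d) ∫ s^(m-d) dF = 1`
for all `m ≥ d` (`choose_mul_integral_agreement_pow`). This prescribes every moment of `F`. A finite
measure on `[0,1]` is determined by its moments (`ext_of_integral_pow_eq`), so `F` has density
`d(1-s)^(d-1)`, or is the Dirac mass at `1` if `d = 0`. The error event is a.e. the union over `I`
of "`H_I` is consistent and `s < 1 - ε`" (`errorEvent_ae_eq_iUnion`). Its probability is `C(m,d)`
times the integral of `s^(m-d)` over `s < 1 - ε`, which is the binomial tail. -/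

/-! ### The binomial tail and its integral form -/

theorem binomialTail_nonneg (d m : ℕ) {ε : ℝ} (hε : ε ∈ Set.Icc (0 : ℝ) 1) :
    0 ≤ binomialTail d m ε := by
  have h : 0 ≤ 1 - ε := by linarith [hε.2]
  have h' := hε.1
  exact Finset.sum_nonneg fun i _ => by positivity

theorem binomialTail_le_one (d m : ℕ) {ε : ℝ} (hε : ε ∈ Set.Icc (0 : ℝ) 1) :
    binomialTail d m ε ≤ 1 := by
  have h : 0 ≤ 1 - ε := by linarith [hε.2]
  have h' := hε.1
  have hfull : binomialTail (m + 1) m ε = 1 := by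
    have := add_pow ε (1 - ε) m
    rw [add_sub_cancel, one_pow] at this
    rw [this, binomialTail]
    exact Finset.sum_congr rfl fun i _ => by ring
  rw [← hfull]
  rcases le_total d (m + 1) with hd | hd
  · exact Finset.sum_le_sum_of_subset_of_nonneg (Finset.range_mono hd)
      fun i _ _ => by positivity
  · refine (Finset.sum_subset (Finset.range_mono hd) fun i _ hi => ?_).ge
    rw [Nat.choose_eq_zero_of_lt (by simpa using hi)]
    simp

theorem tendsto_binomialTail (d : ℕ) {ε : ℝ} (hε : ε ∈ Set.Ioo (0 : ℝ) 1) :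
    Tendsto (fun m => binomialTail d m ε) atTop (𝓝 0) := by
  have h0 : 0 < 1 - ε := by linarith [hε.2]
  have h1 : 1 - ε < 1 := by linarith [hε.1]
  have key : ∀ i ∈ Finset.range d,
      Tendsto (fun m : ℕ => (m.choose i : ℝ) * ε ^ i * (1 - ε) ^ (m - i)) atTop (𝓝 0) := by
    intro i _
    have hlim : Tendsto (fun m : ℕ => ((m : ℝ) ^ i * (1 - ε) ^ m) * (ε ^ i / (1 - ε) ^ i))
        atTop (𝓝 0) := by
      simpa using (tendsto_pow_const_mul_const_pow_of_lt_one i h0.le h1).mul_const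
        (ε ^ i / (1 - ε) ^ i)
    have hε0 := hε.1
    refine squeeze_zero' (Eventually.of_forall fun m => by positivity) ?_ hlim
    filter_upwards [eventually_ge_atTop i] with m hm
    have hc : (m.choose i : ℝ) ≤ (m : ℝ) ^ i := by exact_mod_cast Nat.choose_le_pow m i
    have hp : (1 - ε) ^ m = (1 - ε) ^ (m - i) * (1 - ε) ^ i := by
      rw [← pow_add, Nat.sub_add_cancel hm]
    calc (m.choose i : ℝ) * ε ^ i * (1 - ε) ^ (m - i)
        ≤ (m : ℝ) ^ i * ε ^ i * (1 - ε) ^ (m - i) := by gcongr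
      _ = _ := by rw [hp]; field_simp
  simpa [binomialTail] using tendsto_finsetSum _ key

theorem binomialTail_one {d m : ℕ} (hm : d ≤ m) : binomialTail d m 1 = 0 := by
  refine Finset.sum_eq_zero fun i hi => ?_
  have : m - i ≠ 0 := by have := Finset.mem_range.1 hi; omega
  simp [this]

theorem binomialTail_zero {d : ℕ} (hd : d ≠ 0) (m : ℕ) : binomialTail d m 0 = 1 := by
  obtain ⟨n, rfl⟩ := Nat.exists_eq_succ_of_ne_zero hd
  simp [binomialTail, Finset.sum_range_succ']

/-- The sum of derivatives telescopes: each new term cancels the derivative of the shorter tail and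
leaves a single monomial. -/
theorem hasDerivAt_binomialTail (d m : ℕ) (t : ℝ) :
    HasDerivAt (binomialTail d m)
      (-((m.choose d : ℝ) * d * t ^ (d - 1) * (1 - t) ^ (m - d))) t := by
  induction d with
  | zero =>
    have hfun : binomialTail 0 m = fun _ => 0 := by
      funext s
      simp [binomialTail]
    simpa [hfun] using hasDerivAt_const t (0 : ℝ)
  | succ d ih =>
    have h1 : HasDerivAt (fun s : ℝ => (1 - s) ^ (m - d))
        (((m - d : ℕ) : ℝ) * (1 - t) ^ (m - d - 1) * (-1)) t :=
      ((hasDerivAt_id t).const_sub 1).pow (m - d)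
    have h2 := ((hasDerivAt_pow d t).const_mul (m.choose d : ℝ)).mul h1
    have hfun : binomialTail (d + 1) m =
        fun s => binomialTail d m s + (m.choose d : ℝ) * s ^ d * (1 - s) ^ (m - d) := by
      funext s
      simp [binomialTail, Finset.sum_range_succ]
    rw [hfun]
    have hc : (m.choose (d + 1) : ℝ) * ((d + 1 : ℕ) : ℝ) = m.choose d * ((m - d : ℕ) : ℝ) := by
      exact_mod_cast Nat.choose_succ_right_eq m d
    refine (ih.add h2).congr_deriv ?_
    rw [hc, Nat.add_sub_cancel, Nat.sub_sub]
    ring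

theorem integral_pow_mul_one_sub_pow {d m : ℕ} (hm : d ≤ m) (c : ℝ) :
    ∫ s in (0 : ℝ)..c, (m.choose d : ℝ) * (d * (1 - s) ^ (d - 1) * s ^ (m - d)) =
      binomialTail d m (1 - c) := by
  have h : ∀ s ∈ Set.uIcc 0 c, HasDerivAt (fun s : ℝ => binomialTail d m (1 - s))
      ((m.choose d : ℝ) * (d * (1 - s) ^ (d - 1) * s ^ (m - d))) s := by
    intro s _
    have := (hasDerivAt_binomialTail d m (1 - s)).comp s ((hasDerivAt_id s).const_sub 1)
    refine this.congr_deriv ?_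
    rw [sub_sub_cancel]
    ring
  rw [intervalIntegral.integral_eq_sub_of_hasDerivAt h
    (Continuous.intervalIntegrable (by fun_prop) _ _)]
  simp [binomialTail_one hm]

/-! ### The moment problem on a compact interval -/

/-- By Weierstrass, polynomials approximate bounded continuous functions uniformly on `[a, b]`, and
integrals of the latter determine a finite measure. -/
theorem ext_of_integral_pow_eq {μ ν : Measure ℝ} [IsFiniteMeasure μ] [IsFiniteMeasure ν]
    {a b : ℝ} (hμ : ∀ᵐ x ∂μ, x ∈ Set.Icc a b) (hν : ∀ᵐ x ∂ν, x ∈ Set.Icc a b)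
    (h : ∀ k : ℕ, ∫ x, x ^ k ∂μ = ∫ x, x ^ k ∂ν) : μ = ν := by
  have hint : ∀ (ρ : Measure ℝ) [IsFiniteMeasure ρ], (∀ᵐ x ∂ρ, x ∈ Set.Icc a b) →
      ∀ f : ℝ → ℝ, Continuous f → Integrable f ρ := by
    intro ρ _ hρ f hf
    obtain ⟨C, hC⟩ := isCompact_Icc.exists_bound_of_continuousOn (s := Set.Icc a b) hf.continuousOn
    exact Integrable.of_bound hf.aestronglyMeasurable C (hρ.mono fun x hx => hC x hx)
  have hpoly : ∀ p : Polynomial ℝ, ∫ x, p.eval x ∂μ = ∫ x, p.eval x ∂ν := by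
    intro p
    simp only [Polynomial.eval_eq_sum_range]
    rw [integral_finsetSum _ fun i _ => hint μ hμ _ (by fun_prop),
      integral_finsetSum _ fun i _ => hint ν hν _ (by fun_prop)]
    simp only [integral_const_mul, h]
  have happrox : ∀ (ρ : Measure ℝ) [IsFiniteMeasure ρ], (∀ᵐ x ∂ρ, x ∈ Set.Icc a b) →
      ∀ (f : ℝ → ℝ), Continuous f → ∀ (p : Polynomial ℝ) (η : ℝ),
      (∀ x ∈ Set.Icc a b, |p.eval x - f x| < η) →
      |∫ x, p.eval x ∂ρ - ∫ x, f x ∂ρ| ≤ η * ρ.real Set.univ := by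
    intro ρ _ hρ f hf p η hp
    rw [← integral_sub (hint ρ hρ _ p.continuous) (hint ρ hρ _ hf)]
    exact norm_integral_le_of_norm_le_const (f := fun x => p.eval x - f x)
      (hρ.mono fun x hx => (hp x hx).le)
  refine ext_of_forall_integral_eq_of_IsFiniteMeasure fun f => ?_
  refine eq_of_abs_sub_le_all fun η hη => ?_
  -- With tolerance `η / M` the two approximation errors add up to at most `η`; the `+ 1` keeps `M`
  -- positive.
  set M := μ.real Set.univ + ν.real Set.univ + 1 with hM
  have hμ0 : 0 ≤ μ.real Set.univ := measureReal_nonneg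
  have hν0 : 0 ≤ ν.real Set.univ := measureReal_nonneg
  have hM0 : 0 < M := by positivity
  obtain ⟨p, hp⟩ := exists_polynomial_near_of_continuousOn a b f f.continuous.continuousOn
    (η / M) (by positivity)
  have h1 := happrox μ hμ f f.continuous p _ hp
  have h2 := happrox ν hν f f.continuous p _ hp
  rw [hpoly p] at h1
  have h3 : η / M * μ.real Set.univ + η / M * ν.real Set.univ ≤ η := by
    have : η / M * M = η := by field_simp
    have h4 : 0 < η / M := by positivity
    nlinarith
  rw [abs_le] at *
  constructor <;> linarith [h1.1, h1.2, h2.1, h2.2]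

theorem choose_mul_setIntegral_pow_eq_binomialTail {d : ℕ} {F : Measure ℝ} [IsFiniteMeasure F]
    (hF : ∀ᵐ s ∂F, s ∈ Set.Icc (0 : ℝ) 1)
    (hmom : ∀ m, d ≤ m → (m.choose d : ℝ) * ∫ s, s ^ (m - d) ∂F = 1)
    {c : ℝ} (hc : c ∈ Set.Icc (0 : ℝ) 1) {m : ℕ} (hm : d ≤ m) :
    (m.choose d : ℝ) * ∫ s in Set.Iio c, s ^ (m - d) ∂F = binomialTail d m (1 - c) := by
  -- For `d = 0` all moments are `1`, so `F` is the Dirac mass at `1`, which `s < c ≤ 1` misses. The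
  -- density used below would be zero here.
  rcases eq_or_ne d 0 with rfl | hd
  · have h : F = Measure.dirac 1 := by
      refine ext_of_integral_pow_eq (a := 0) (b := 1) hF ?_ fun k => ?_
      · exact (ae_dirac_iff (measurableSet_Icc (a := (0 : ℝ)) (b := 1))).2 (by simp)
      · simpa using hmom k (Nat.zero_le k)
    rw [h, setIntegral_measure_zero]
    · simp [binomialTail]
    · rw [Measure.dirac_apply' _ measurableSet_Iio]
      simp [hc.2]
  set w : ℝ → ENNReal := fun s => ENNReal.ofReal (d * (1 - s) ^ (d - 1)) with hw
  have hwm : Measurable w := by fun_prop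
  set ν : Measure ℝ := (volume.restrict (Set.Ioc 0 1)).withDensity w with hν
  have hset : ∀ (c' : ℝ), c' ∈ Set.Icc (0 : ℝ) 1 → ∀ n, d ≤ n →
      (n.choose d : ℝ) * ∫ s in Set.Iic c', s ^ (n - d) ∂ν = binomialTail d n (1 - c') := by
    intro c' hc' n hn
    rw [← integral_pow_mul_one_sub_pow hn, intervalIntegral.integral_const_mul,
      intervalIntegral.integral_of_le hc'.1, hν,
      setIntegral_withDensity_eq_setIntegral_toReal_smul hwm
        (ae_of_all _ fun _ => ENNReal.ofReal_lt_top) _ measurableSet_Iic,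
      Measure.restrict_restrict measurableSet_Iic,
      show Set.Iic c' ∩ Set.Ioc 0 1 = Set.Ioc 0 c' by
        ext s
        simp only [Set.mem_inter_iff, Set.mem_Iic, Set.mem_Ioc]
        exact ⟨fun h => ⟨h.2.1, h.1⟩, fun h => ⟨h.2, h.1, h.2.trans hc'.2⟩⟩]
    congr 1
    refine setIntegral_congr_fun measurableSet_Ioc fun s hs => ?_
    have : 0 ≤ 1 - s := by linarith [hs.2, hc'.2]
    simp only [hw, smul_eq_mul]
    rw [ENNReal.toReal_ofReal (by positivity)]
  have hνI : ∀ᵐ s ∂ν, s ∈ Set.Ioc (0 : ℝ) 1 :=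
    (withDensity_absolutelyContinuous _ _).ae_le (ae_restrict_mem measurableSet_Ioc)
  have : IsFiniteMeasure ν := by
    refine isFiniteMeasure_withDensity ?_
    refine ne_of_lt (lt_of_le_of_lt (setLIntegral_mono (g := fun _ => (d : ENNReal))
      measurable_const fun s hs => ?_) ?_)
    · simp only [hw]
      rw [← ENNReal.ofReal_natCast]
      refine ENNReal.ofReal_le_ofReal (mul_le_of_le_one_right (by positivity) ?_)
      exact pow_le_one₀ (by linarith [hs.2]) (by linarith [hs.1])
    · simp
  have hFν : F = ν := by
    refine ext_of_integral_pow_eq (a := 0) (b := 1) hF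
      (hνI.mono fun s hs => Set.Ioc_subset_Icc_self hs) fun k => ?_
    -- Sample size `k + d` isolates the `k`-th moment; for `ν` the normalisation is the tail at `ε =
    -- 0`, equal to `1`.
    have h1 := hmom (k + d) (Nat.le_add_left d k)
    have h2 := hset 1 (by simp) (k + d) (Nat.le_add_left d k)
    rw [sub_self, binomialTail_zero hd, ← integral_indicator measurableSet_Iic] at h2
    rw [integral_congr_ae (g := fun s => s ^ (k + d - d))] at h2
    · have hne : ((k + d).choose d : ℝ) ≠ 0 := by
        exact_mod_cast (Nat.choose_pos (Nat.le_add_left d k)).ne'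
      rw [Nat.add_sub_cancel] at h1 h2
      exact mul_left_cancel₀ hne (h1.trans h2.symm)
    · filter_upwards [hνI] with s hs
      simp [hs.2]
  -- `ν` has no atoms, so the strict inequality may be relaxed.
  have hIio : (Set.Iio c : Set ℝ) =ᵐ[ν] Set.Iic c :=
    ((withDensity_absolutelyContinuous _ _).trans Measure.absolutelyContinuous_restrict).ae_le
      Iio_ae_eq_Iic
  rw [hFν, setIntegral_congr_set hIio, hset c hc m hm]

/-! ### Splitting a multisample into a subsample and the rest -/

theorem measurePreserving_subsample_compl {Δ : Type*} [MeasurableSpace Δ] (P : Measure Δ)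
    [IsProbabilityMeasure P] {d m : ℕ} (I : IndexSet d m) :
    MeasurePreserving
      (fun δ : Fin m → Δ => (subsample δ I, fun j : {j // j ∉ I.1} => δ j))
      (sampleLaw P m) ((sampleLaw P d).prod (Measure.pi fun _ => P)) := by
  have h1 := measurePreserving_piEquivPiSubtypeProd (fun _ : Fin m => P) (fun j => j ∈ I.1)
  have h2 := measurePreserving_arrowCongr' (fun _ : I.1 => P) (fun _ : Fin d => P)
    (I.1.orderIsoOfFin I.2).symm.toEquiv (MeasurableEquiv.refl Δ)
    (fun _ => MeasurePreserving.id P)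
  exact (h2.prod (MeasurePreserving.id (Measure.pi fun _ : {j // j ∉ I.1} => P))).comp (by convert h1)

/-- Fubini: once the subsample is fixed in `B`, the condition on the other `m - d` coordinates is a
box with equal sides. -/
theorem sampleLaw_subsample_forall_compl {Δ : Type*} [MeasurableSpace Δ] (P : Measure Δ)
    [IsProbabilityMeasure P] {d m : ℕ} (I : IndexSet d m) {D : Set ((Fin d → Δ) × Δ)}
    (hD : MeasurableSet D) {B : Set (Fin d → Δ)} (hB : MeasurableSet B) :
    sampleLaw P m {δ | subsample δ I ∈ B ∧ ∀ j ∉ I.1, (subsample δ I, δ j) ∈ D} =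
      ∫⁻ x in B, P (Prod.mk x ⁻¹' D) ^ (m - d) ∂sampleLaw P d := by
  set E : Set ((Fin d → Δ) × ({j // j ∉ I.1} → Δ)) :=
    Prod.fst ⁻¹' B ∩ ⋂ j, (fun p => (p.1, p.2 j)) ⁻¹' D with hE
  have hEm : MeasurableSet E := by
    refine (measurable_fst hB).inter (MeasurableSet.iInter fun j => ?_)
    exact (show Measurable fun p : (Fin d → Δ) × ({j // j ∉ I.1} → Δ) => (p.1, p.2 j) by
      fun_prop) hD
  have hpre : {δ : Fin m → Δ | subsample δ I ∈ B ∧ ∀ j ∉ I.1, (subsample δ I, δ j) ∈ D} =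
      (fun δ : Fin m → Δ => (subsample δ I, fun j : {j // j ∉ I.1} => δ j)) ⁻¹' E := by
    ext δ
    simp [hE]
  rw [hpre, (measurePreserving_subsample_compl P I).measure_preimage hEm.nullMeasurableSet,
    Measure.prod_apply hEm, ← lintegral_indicator hB]
  refine lintegral_congr fun x => ?_
  by_cases hx : x ∈ B
  · have : Prod.mk x ⁻¹' E = Set.univ.pi fun _ => Prod.mk x ⁻¹' D := by
      ext w
      simp [hE, hx]
    rw [this, Measure.pi_pi, Set.indicator_of_mem hx]
    simp [Fintype.card_subtype_compl, I.2]
  · have : Prod.mk x ⁻¹' E = ∅ := by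
      ext w
      simp [hE, hx]
    simp [this, hx]

/-- The pairs `(x, y)` such that the hypothesis compressed from `x` labels `y` correctly. -/
def agreementSet {Δ : Type*} [MeasurableSpace Δ] (T : Concept Δ) {d : ℕ}
    (G : (Fin d → Δ × Bool) → Concept Δ) : Set ((Fin d → Δ) × Δ) :=
  {p | (G (label T p.1)).ind p.2 = T.ind p.2}

/-- The probability that the hypothesis compressed from `x` labels a random point correctly. -/
noncomputable def agreement {Δ : Type*} [MeasurableSpace Δ] (P : Measure Δ) (T : Concept Δ)
    {d : ℕ} (G : (Fin d → Δ × Bool) → Concept Δ) (x : Fin d → Δ) : ℝ :=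
  P.real (Prod.mk x ⁻¹' agreementSet T G)

/-! ### Consistency events, moments of the agreement, and the error event -/

section

variable {Δ : Type*} [MeasurableSpace Δ] {P : Measure Δ}
  {T : Concept Δ} {d : ℕ} {G : (Fin d → Δ × Bool) → Concept Δ}

theorem IndexSet.card_eq_choose (d m : ℕ) : Fintype.card (IndexSet d m) = m.choose d := by
  rw [Fintype.card_finset_len, Fintype.card_fin]

theorem UniqueConsistency.mem_consistencyEvent_iff (hG : UniqueConsistency P T G) {m : ℕ}
    (hm : d ≤ m) (I : IndexSet d m) (δ : Fin m → Δ) :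
    δ ∈ consistencyEvent T G I ↔ ∀ j ∉ I.1, (subsample δ I, δ j) ∈ agreementSet T G := by
  refine ⟨fun h j _ => h j, fun h j => ?_⟩
  by_cases hj : j ∈ I.1
  · obtain ⟨k, rfl⟩ : j ∈ Set.range (I.1.orderEmbOfFin I.2) := by
      simpa using hj
    exact hG.consistent_subsample m hm δ I k
  · exact h j hj

/-- Take `m = d + 1` and let `I` be the first `d` indices. Only the last point is then tested, so
the set is a preimage of a consistency event under appending a point. -/
theorem measurableSet_agreementSet
    (hmeas : ∀ m : ℕ, d ≤ m → ∀ I : IndexSet d m, MeasurableSet (consistencyEvent T G I))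
    (hG : UniqueConsistency P T G) : MeasurableSet (agreementSet T G) := by
  let I : IndexSet d (d + 1) := ⟨Finset.univ.map Fin.castSuccEmb, by simp⟩
  have hI : ∀ k, I.1.orderEmbOfFin I.2 k = k.castSucc := fun k =>
    congrFun (Finset.orderEmbOfFin_unique I.2 (f := Fin.castSucc) (by simp [I])
      Fin.strictMono_castSucc).symm k
  have hφ : Measurable fun p : (Fin d → Δ) × Δ => (Fin.snoc p.1 p.2 : Fin (d + 1) → Δ) := by
    refine measurable_pi_lambda _ fun i => ?_
    induction i using Fin.lastCases with
    | last => simpa using measurable_snd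
    | cast i =>
      simp only [Fin.snoc_castSucc]
      exact (measurable_pi_apply i).comp measurable_fst
  convert hφ (hmeas (d + 1) (Nat.le_succ d) I)
  ext p
  have hsub : subsample (Fin.snoc p.1 p.2 : Fin (d + 1) → Δ) I = p.1 := by
    funext k
    simp [subsample, hI]
  rw [Set.mem_preimage, hG.mem_consistencyEvent_iff (Nat.le_succ d), hsub]
  have hlast : Fin.last d ∉ I.1 := by
    simp [I, Fin.castSucc_ne_last]
  refine ⟨fun h j hj => ?_, fun h => by simpa using h _ hlast⟩
  induction j using Fin.lastCases with
  | last => simpa using h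
  | cast i => exact absurd (by simp [I]) hj

theorem UniqueConsistency.exists_isCompressing (hG : UniqueConsistency P T G) :
    ∃ μ : IndexSelection Δ d, IsCompressing P T G μ := by
  have hne : ∀ m, d ≤ m → Nonempty (IndexSet d m) := fun m hm => by
    rw [← Fintype.card_pos_iff, IndexSet.card_eq_choose]
    exact Nat.choose_pos hm
  -- The value is arbitrary on multisamples with no consistent choice; these form a null set.
  refine ⟨fun m hm z => @Classical.epsilon _ (hne m hm)
    fun I => IsConsistent (G (subsample z I)) z, fun m hm => ?_⟩
  filter_upwards [hG.existsUnique m hm] with δ hu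
  exact Classical.epsilon_spec hu.exists

variable [IsProbabilityMeasure P]

instance isProbabilityMeasure_sampleLaw (m : ℕ) : IsProbabilityMeasure (sampleLaw P m) := by
  unfold sampleLaw
  infer_instance

theorem measurable_agreement (hD : MeasurableSet (agreementSet T G)) :
    Measurable (agreement P T G) :=
  (measurable_measure_prodMk_left hD).ennreal_toReal

theorem agreement_mem_Icc (x : Fin d → Δ) : agreement P T G x ∈ Set.Icc (0 : ℝ) 1 :=
  ⟨measureReal_nonneg, measureReal_le_one⟩

theorem errorDist_eq_one_sub_agreement (hD : MeasurableSet (agreementSet T G))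
    (x : Fin d → Δ) : errorDist P T (G (label T x)) = 1 - agreement P T G x :=
  probReal_compl_eq_one_sub (measurable_prodMk_left hD)

theorem sampleLaw_consistencyEvent_inter (hD : MeasurableSet (agreementSet T G))
    (hG : UniqueConsistency P T G) {m : ℕ} (hm : d ≤ m) (I : IndexSet d m) {C : Set ℝ}
    (hC : MeasurableSet C) :
    (sampleLaw P m).real
        (consistencyEvent T G I ∩ {δ | agreement P T G (subsample δ I) ∈ C}) =
      ∫ s in C, s ^ (m - d) ∂(sampleLaw P d).map (agreement P T G) := by
  have ha := measurable_agreement (P := P) hD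
  have hset : consistencyEvent T G I ∩ {δ | agreement P T G (subsample δ I) ∈ C} =
      {δ | subsample δ I ∈ agreement P T G ⁻¹' C ∧
        ∀ j ∉ I.1, (subsample δ I, δ j) ∈ agreementSet T G} := by
    ext δ
    rw [Set.mem_inter_iff, hG.mem_consistencyEvent_iff hm, and_comm]
    rfl
  rw [hset, measureReal_def, sampleLaw_subsample_forall_compl P I hD (ha hC),
    setIntegral_map hC (by fun_prop) ha.aemeasurable, ← integral_toReal]
  · simp [agreement, measureReal_def]
  · exact ((measurable_measure_prodMk_left hD).pow_const _).aemeasurable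
  · exact ae_of_all _ fun x => ENNReal.pow_lt_top (measure_lt_top _ _)

/-- Uniqueness makes the events a.e. disjoint, and each of the `C(m,d)` index sets contributes the
same integral. -/
theorem sampleLaw_iUnion_consistencyEvent_inter
    (hmeas : ∀ m : ℕ, d ≤ m → ∀ I : IndexSet d m, MeasurableSet (consistencyEvent T G I))
    (hG : UniqueConsistency P T G) {m : ℕ} (hm : d ≤ m) {C : Set ℝ} (hC : MeasurableSet C) :
    NullMeasurableSet
        (⋃ I : IndexSet d m,
          consistencyEvent T G I ∩ {δ | agreement P T G (subsample δ I) ∈ C})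
        (sampleLaw P m) ∧
      (sampleLaw P m).real
          (⋃ I : IndexSet d m,
            consistencyEvent T G I ∩ {δ | agreement P T G (subsample δ I) ∈ C}) =
        (m.choose d : ℝ) *
          ∫ s in C, s ^ (m - d) ∂(sampleLaw P d).map (agreement P T G) := by
  have hD := measurableSet_agreementSet hmeas hG
  have hE : ∀ I : IndexSet d m, NullMeasurableSet
      (consistencyEvent T G I ∩ {δ | agreement P T G (subsample δ I) ∈ C})
      (sampleLaw P m) := by
    intro I
    refine ((hmeas m hm I).inter ?_).nullMeasurableSet
    exact ((measurable_agreement hD).comp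
      (measurable_pi_lambda _ fun k => measurable_pi_apply _)) hC
  refine ⟨NullMeasurableSet.iUnion hE, ?_⟩
  have hdisj : Pairwise (Function.onFun (AEDisjoint (sampleLaw P m)) fun I : IndexSet d m =>
      consistencyEvent T G I ∩ {δ | agreement P T G (subsample δ I) ∈ C}) := by
    intro I J hIJ
    refine measure_mono_null (fun δ hδ => ?_) (ae_iff.1 (hG.existsUnique m hm))
    exact fun h => hIJ (h.unique hδ.1.1 hδ.2.1)
  rw [measureReal_def, measure_iUnion₀ hdisj hE, tsum_fintype,
    ENNReal.toReal_sum fun I _ => measure_ne_top _ _]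
  simp_rw [← measureReal_def, sampleLaw_consistencyEvent_inter hD hG hm _ hC]
  rw [Finset.sum_const, Finset.card_univ, IndexSet.card_eq_choose, nsmul_eq_mul]

theorem choose_mul_integral_agreement_pow
    (hmeas : ∀ m : ℕ, d ≤ m → ∀ I : IndexSet d m, MeasurableSet (consistencyEvent T G I))
    (hG : UniqueConsistency P T G) {m : ℕ} (hm : d ≤ m) :
    (m.choose d : ℝ) * ∫ s, s ^ (m - d) ∂(sampleLaw P d).map (agreement P T G) = 1 := by
  have h := (sampleLaw_iUnion_consistencyEvent_inter hmeas hG hm MeasurableSet.univ).2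
  rw [Measure.restrict_univ] at h
  rw [← h, measureReal_congr (t := Set.univ), probReal_univ]
  filter_upwards [hG.existsUnique m hm] with δ hu
  obtain ⟨I, hI⟩ := hu.exists
  exact propext ⟨fun _ => trivial, fun _ => Set.mem_iUnion.2 ⟨I, hI, trivial⟩⟩

/-- Almost surely the selected index set is the unique consistent one, so no measurability of the
selection is needed. -/
theorem errorEvent_ae_eq_iUnion (hD : MeasurableSet (agreementSet T G))
    (hG : UniqueConsistency P T G) {μ : IndexSelection Δ d} (hμ : IsCompressing P T G μ)
    {m : ℕ} (hm : d ≤ m) (ε : ℝ) :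
    errorEvent P T (compressionAlgorithm G μ) m hm ε =ᵐ[sampleLaw P m]
      ⋃ I : IndexSet d m, consistencyEvent T G I ∩
        {δ | agreement P T G (subsample δ I) ∈ Set.Iio (1 - ε)} := by
  have hiff : ∀ (δ : Fin m → Δ) (I : IndexSet d m),
      ε < errorDist P T (G (subsample (label T δ) I)) ↔
        agreement P T G (subsample δ I) ∈ Set.Iio (1 - ε) := by
    intro δ I
    rw [show subsample (label T δ) I = label T (subsample δ I) from rfl,
      errorDist_eq_one_sub_agreement hD, Set.mem_Iio, lt_sub_comm]
  filter_upwards [hG.existsUnique m hm, hμ m hm] with δ hu hc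
  refine propext ⟨fun h => Set.mem_iUnion.2 ⟨_, hc, (hiff δ _).1 h⟩, fun h => ?_⟩
  obtain ⟨I, hI, hIC⟩ := Set.mem_iUnion.1 h
  obtain rfl := hu.unique hI hc
  exact (hiff δ _).2 hIC

end

end CompressionLearning

theorem mainTheorem1 {Δ : Type*} [MeasurableSpace Δ] (P : Measure Δ) [IsProbabilityMeasure P]
    (T : CompressionLearning.Concept Δ) (d : ℕ)
    (G : (Fin d → Δ × Bool) → CompressionLearning.Concept Δ)
    (hmeas : ∀ m : ℕ, d ≤ m → ∀ I : CompressionLearning.IndexSet d m,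
      MeasurableSet (CompressionLearning.consistencyEvent T G I))
    (hG : CompressionLearning.UniqueConsistency P T G) :
    (∃ μ : CompressionLearning.IndexSelection Δ d, CompressionLearning.IsCompressing P T G μ) ∧
    ∀ μ : CompressionLearning.IndexSelection Δ d, CompressionLearning.IsCompressing P T G μ →
      CompressionLearning.IsPACTWith P T (CompressionLearning.compressionAlgorithm G μ)
        (CompressionLearning.binomialTail d) ∧
      ∀ ε ∈ Set.Ioo (0 : ℝ) 1, ∀ (m : ℕ) (hm : d ≤ m),
        NullMeasurableSet
          (CompressionLearning.errorEvent P T (CompressionLearning.compressionAlgorithm G μ) m hm ε)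
          (CompressionLearning.sampleLaw P m) ∧
        (CompressionLearning.sampleLaw P m).real
          (CompressionLearning.errorEvent P T (CompressionLearning.compressionAlgorithm G μ) m hm ε)
          = ∑ i ∈ Finset.range d, (m.choose i : ℝ) * ε ^ i * (1 - ε) ^ (m - i) := by
  have hD := CompressionLearning.measurableSet_agreementSet hmeas hG
  refine ⟨hG.exists_isCompressing, fun μ hμ => ?_⟩
  have key : ∀ ε ∈ Set.Ioo (0 : ℝ) 1, ∀ (m : ℕ) (hm : d ≤ m),
      NullMeasurableSet
        (CompressionLearning.errorEvent P T (CompressionLearning.compressionAlgorithm G μ) m hm ε)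
        (CompressionLearning.sampleLaw P m) ∧
      (CompressionLearning.sampleLaw P m).real
        (CompressionLearning.errorEvent P T (CompressionLearning.compressionAlgorithm G μ) m hm ε)
        = CompressionLearning.binomialTail d m ε := by
    intro ε hε m hm
    have hae := CompressionLearning.errorEvent_ae_eq_iUnion hD hG hμ hm ε
    obtain ⟨h1, h2⟩ := CompressionLearning.sampleLaw_iUnion_consistencyEvent_inter
      hmeas hG hm (measurableSet_Iio (a := 1 - ε))
    refine ⟨h1.congr hae.symm, ?_⟩
    have ha := (CompressionLearning.measurable_agreement (P := P) hD).aemeasurable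
      (μ := CompressionLearning.sampleLaw P d)
    rw [measureReal_congr hae, h2,
      CompressionLearning.choose_mul_setIntegral_pow_eq_binomialTail
        ((ae_map_iff ha measurableSet_Icc).2
          (ae_of_all _ CompressionLearning.agreement_mem_Icc))
        (fun n hn => CompressionLearning.choose_mul_integral_agreement_pow hmeas hG hn)
        ⟨by linarith [hε.2], by linarith [hε.1]⟩ hm, sub_sub_cancel]
  refine ⟨⟨fun m ε hε => ?_, fun ε hε => CompressionLearning.tendsto_binomialTail d hε,
    fun ε hε m hm => (key ε hε m hm).2.le⟩, key⟩
  exact ⟨CompressionLearning.binomialTail_nonneg d m (Set.Ioo_subset_Icc_self hε),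
    CompressionLearning.binomialTail_le_one d m (Set.Ioo_subset_Icc_self hε)⟩
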